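/- Consider the linear model $\mathbf y=\mathbf X\boldsymbol\beta+\mathbf w$ with a fixed design $\mathbf X\in\mathbb R^{n\times p}$, a fixed unknown $\boldsymbol\beta\in\mathbb R^p$ and noise $\mathbf w\sim\mathcal N(0,\sigma^2\mathbf I_n)$, $\sigma>0$. Let $\widetilde{\mathbf X}\in\mathbb R^{n\times p}$ be a fixed-X knockoff design for $\mathbf X$, that is, with $\boldsymbol\Sigma=\mathbf X^\top\mathbf X$ and some $\mathbf s\in\mathbb R^p$, $$\mathbf G:=[\mathbf X\ \widetilde{\mathbf X}]^\top[\mathbf X\ \widetilde{\mathbf X}]=\begin{bmatrix}\boldsymbol\Sigma&\boldsymbol\Sigma-\mathrm{diag}\{\mathbf s\}\\ \boldsymbol\Sigma-\mathrm{diag}\{\mathbf s\}&\boldsymbol\Sigma\end{bmatrix},$$ and assume that $\mathbf G$ is invertible. Let $\delta\ge 0$, let $\delta'_1,\dots,\delta'_p\le-\delta$, and let $$\begin{pmatrix}\hat{\boldsymbol\beta}\\ \hat{\boldsymbol\beta}'\end{pmatrix}=\mathbf G^{-1}[\mathbf X\ \widetilde{\mathbf X}]^\top\mathbf y+\begin{pmatrix}0\\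 \boldsymbol\delta'\end{pmatrix}$$ be the shifted ordinary least-squares estimates. Let $\boldsymbol W=(W_1,\dots,W_p)$ be a (measurable) function of $(\hat{\boldsymbol\beta},\hat{\boldsymbol\beta}')$ that is antisymmetric, i.e. for each $F\subseteq\{1,\dots,p\}$, swapping the two arguments $\hat\beta_i$ and $\hat\beta'_i$ for all $i\in F$ changes the sign of $W_i$ for $i\in F$ and leaves $W_i$ unchanged for $i\notin F$, and that satisfies $\mathrm{sgn}(W_j)=\mathrm{sgn}\big(|\hat\beta_j|-|\hat\beta'_j|\big)$ for all $j$. For a target level $q\in[0,1]$, the knockoff procedure selects $\hat{\mathcal S}=\{j:W_j\ge T\}$, where $$T=\inf\Big\{t\in\{|W_1|,\dots,|W_p|\}\setminus\{0\}:\ \frac{1+\#\{j:W_j\le -t\}}{\max(\#\{j:W_j\ge t\},1)}\le q\Big\}\qquad(\inf\emptyset=+\infty).$$ Let $\mathcal S_0=\{j:|\beta_j|\le\delta\}$ be the set of true two-sided composite nulls. Then $$\mathrm{FDR}:=\mathbb E\left[\frac{|\hat{\mathcal S}\cap\mathcal S_0|}{\max(|\hat{\mathcal S}|,1)}\right]\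 \le\ q+\mathbb P\Big\{\max_{j\in\mathcal S_0}\big(\hat\beta_j+\hat\beta'_j\big)>0\Big\},$$ where the maximum over the empty set is $-\infty$. -/

import Mathlib

open MeasureTheory ProbabilityTheory Matrix

noncomputable section

namespace FixedXKnockoff

variable {n p : ℕ}

/-- The Gram matrix `G = [X X̃]ᵀ [X X̃]` of the augmented design. Columns `Sum.inl j` are the
original features and columns `Sum.inr j` their knockoffs. -/
def augGram (X Xk : Matrix (Fin n) (Fin p) ℝ) : Matrix (Fin p ⊕ Fin p) (Fin p ⊕ Fin p) ℝ :=
  (fromCols X Xk)ᵀ * fromCols X Xk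

/-- `Xk` is a fixed-X knockoff design for `X` with parameter vector `s`: with `Σ = Xᵀ X`, the
augmented Gram matrix is `[Σ, Σ - diag s; Σ - diag s, Σ]`. -/
def IsKnockoffDesign (X Xk : Matrix (Fin n) (Fin p) ℝ) (s : Fin p → ℝ) : Prop :=
  augGram X Xk =
    fromBlocks (Xᵀ * X) (Xᵀ * X - diagonal s) (Xᵀ * X - diagonal s) (Xᵀ * X)

/-- The ordinary least-squares estimate `G⁻¹ [X X̃]ᵀ y` over the augmented design
(used only when `G` is invertible). -/
def olsEstimate (X Xk : Matrix (Fin n) (Fin p) ℝ) (y : Fin n → ℝ) : Fin p ⊕ Fin p → ℝ :=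
  (augGram X Xk)⁻¹ *ᵥ ((fromCols X Xk)ᵀ *ᵥ y)

/-- The first `p` entries `β̂` of the shifted OLS estimate (these are not shifted). -/
def solsOriginal (X Xk : Matrix (Fin n) (Fin p) ℝ) (y : Fin n → ℝ) : Fin p → ℝ :=
  fun j => olsEstimate X Xk y (Sum.inl j)

/-- The last `p` entries `β̂'` of the shifted OLS estimate, shifted by the vector `shift`. -/
def solsKnockoff (X Xk : Matrix (Fin n) (Fin p) ℝ) (shift : Fin p → ℝ) (y : Fin n → ℝ) :
    Fin p → ℝ :=
  fun j => olsEstimate X Xk y (Sum.inr j) + shift j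

/-- A statistic `w`, a function of the two halves `a`, `b` of the vector of estimates, is
antisymmetric: swapping `a i` and `b i` for all `i ∈ F` flips the signs of the statistics with
index in `F` and leaves the other ones unchanged. -/
def IsAntisymmetric (w : (Fin p → ℝ) → (Fin p → ℝ) → Fin p → ℝ) : Prop :=
  ∀ (F : Finset (Fin p)) (a b : Fin p → ℝ) (i : Fin p),
    w (F.piecewise b a) (F.piecewise a b) i = if i ∈ F then -w a b i else w a b i

/-- The estimated false discovery proportion
`(1 + #{j : W j ≤ -t}) / (#{j : W j ≥ t} ∨ 1)`. -/
def fdpHat (W : Fin p → ℝ) (t : ℝ) : ℝ :=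
  (1 + ((Finset.univ.filter fun j => W j ≤ -t).card : ℝ)) /
    max ((Finset.univ.filter fun j => t ≤ W j).card : ℝ) 1

/-- The knockoff threshold: the infimum of the `t ∈ {|W i|} \ {0}` with `fdpHat W t ≤ q`.
It is `⊤` when there is no such `t`. -/
def threshold (q : ℝ) (W : Fin p → ℝ) : EReal :=
  sInf ((fun t : ℝ => (t : EReal)) ''
    {t : ℝ | t ∈ Set.range (fun i => |W i|) \ {0} ∧ fdpHat W t ≤ q})

open Classical in
/-- The set of variables selected by the knockoff procedure with target level `q`. -/
def selected (q : ℝ) (W : Fin p → ℝ) : Finset (Fin p) :=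
  Finset.univ.filter fun j => threshold q W ≤ (W j : EReal)

/-- The set of true two-sided composite nulls, `{j : |β j| ≤ δ}`. -/
def nullSet (β : Fin p → ℝ) (δ : ℝ) : Finset (Fin p) :=
  Finset.univ.filter fun j => |β j| ≤ δ

/-- The false discovery proportion of a selected set `S` for the true nulls `S₀`. -/
def fdp (S S₀ : Finset (Fin p)) : ℝ :=
  ((S ∩ S₀).card : ℝ) / max (S.card : ℝ) 1

/-- The false discovery rate of the random selected set `S`. -/
def FDR {Ω : Type*} [MeasurableSpace Ω] (P : Measure Ω) (S : Ω → Finset (Fin p))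
    (S₀ : Finset (Fin p)) : ℝ :=
  ∫ ω, fdp (S ω) S₀ ∂P

end FixedXKnockoff

end

open MeasureTheory ProbabilityTheory Matrix

noncomputable section

namespace FixedXKnockoff

variable {n p : ℕ}

/-! ### The knockoff threshold -/

/-! Let `D_j = β̂_j - β̂'_j`, and let E be the event that `β̂_k + β̂'_k ≤ 0` for every null k. Off E
the bound FDP ≤ 1 produces the probability term. On E, a null with `W_j > 0` has `D_j (β̂_j + β̂'_j)
> 0`, hence `D_j < 0`. Yet `D_j` is Gaussian with mean `β_j - δ'_j ≥ β_j + δ ≥ 0`, and it is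
independent of the estimates symmetrized at j because the contrast of feature j with its knockoff is
an eigenvector of G⁻¹. Reflecting `D_j` amounts to swapping the pair j, which preserves E, `|W_j|`
and every other `W_k`. So a nonnegative weight built from the latter and vanishing at `W_j = 0` has
an integral over E ∩ {W_j > 0} at most its integral over {W_j < 0} (`lintegral_looWeight_pos_le`).

The weights come from a leave-one-out argument, which needs only one swap at a time and no
martingale. The stopping rule bounds the FDP by q times a sum of `looWeight` over nulls with `W_j >
0` (`fdp_selected_le`). Computing the threshold with `|W_j|` in place of `W_j` changes nothing for
these nulls and makes the weight blind to the sign of `W_j`. After the exchange of signs, the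
weights of the nulls with `W_j < 0` sum to at most 1 pointwise (`sum_looWeight_neg_le_one`), which
leaves q. -/

lemma threshold_le {q t : ℝ} {W : Fin p → ℝ} (ht : t ∈ Set.range (fun i => |W i|) \ {0})
    (h : fdpHat W t ≤ q) : threshold q W ≤ t :=
  sInf_le ⟨t, ⟨ht, h⟩, rfl⟩

/-- The threshold is attained when it is finite. -/
lemma threshold_eq_top_or_attained (q : ℝ) (W : Fin p → ℝ) :
    threshold q W = ⊤ ∨
      ∃ t : ℝ, threshold q W = t ∧ t ∈ Set.range (fun i => |W i|) \ {0} ∧ fdpHat W t ≤ q := by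
  unfold threshold
  set S := {t : ℝ | t ∈ Set.range (fun i => |W i|) \ {0} ∧ fdpHat W t ≤ q} with hS
  rcases S.eq_empty_or_nonempty with h | h
  · left; simp [h]
  · right
    have hfin : S.Finite := (Set.finite_range fun i => |W i|).subset fun t ht => ht.1.1
    obtain ⟨t, ht, hte⟩ := (h.image (fun t : ℝ => (t : EReal))).csInf_mem (hfin.image _)
    exact ⟨t, hte.symm, ht⟩

lemma pos_of_mem_range_abs {t : ℝ} {W : Fin p → ℝ}
    (ht : t ∈ Set.range (fun i => |W i|) \ {0}) : 0 < t := by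
  obtain ⟨⟨i, rfl⟩, h⟩ := ht
  exact lt_of_le_of_ne (abs_nonneg _) (Ne.symm h)

lemma threshold_pos (q : ℝ) (W : Fin p → ℝ) : 0 < threshold q W := by
  rcases threshold_eq_top_or_attained q W with h | ⟨t, h, ht, -⟩
  · simp [h]
  · rw [h]; exact_mod_cast pos_of_mem_range_abs ht

/-! ### Leave-one-out weights -/

/-- The vector `W` with its `j`-th entry replaced by its absolute value. -/
def absAt (W : Fin p → ℝ) (j : Fin p) : Fin p → ℝ := Function.update W j |W j|

lemma absAt_of_nonneg {W : Fin p → ℝ} {j : Fin p} (h : 0 ≤ W j) : absAt W j = W := by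
  simp [absAt, abs_of_nonneg h]

lemma abs_absAt (W : Fin p → ℝ) (j i : Fin p) : |absAt W j i| = |W i| := by
  rcases eq_or_ne i j with rfl | h <;> simp [absAt, *]

lemma absAt_update_neg (W : Fin p → ℝ) (j : Fin p) :
    absAt (Function.update W j (-W j)) j = absAt W j := by
  simp [absAt]

open Classical in
/-- The weight of the null `j`: the inverse of `1 + #{k ∈ S₀ \ {j} : W k ≤ -T}` if `|W j| ≥ T` and
`0` otherwise, where the threshold `T` is computed as if `W j` were nonnegative. -/
def looWeight (q : ℝ) (S₀ : Finset (Fin p)) (W : Fin p → ℝ) (j : Fin p) : ℝ :=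
  if threshold q (absAt W j) ≤ (|W j| : ℝ) then
    (1 + (((S₀.erase j).filter
      fun k => threshold q (absAt W j) ≤ ((-W k : ℝ) : EReal)).card : ℝ))⁻¹
  else 0

lemma looWeight_nonneg (q : ℝ) (S₀ : Finset (Fin p)) (W : Fin p → ℝ) (j : Fin p) :
    0 ≤ looWeight q S₀ W j := by
  unfold looWeight; split_ifs <;> positivity

lemma looWeight_of_eq_zero {q : ℝ} {S₀ : Finset (Fin p)} {W : Fin p → ℝ} {j : Fin p}
    (h : W j = 0) : looWeight q S₀ W j = 0 := by
  unfold looWeight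
  rw [if_neg]
  simpa [h] using threshold_pos q (absAt W j)

/-- Both the threshold and the count of negatives ignore the sign of `W j`; this is why the count
runs over `S₀.erase j`. It makes the weight invariant under the swap at `j`. -/
lemma looWeight_update_neg (q : ℝ) (S₀ : Finset (Fin p)) (W : Fin p → ℝ) (j : Fin p) :
    looWeight q S₀ (Function.update W j (-W j)) j = looWeight q S₀ W j := by
  unfold looWeight
  rw [absAt_update_neg]
  simp only [Function.update_self, abs_neg]
  congr 5
  refine Finset.filter_congr fun k hk => ?_
  rw [Function.update_of_ne (Finset.ne_of_mem_erase hk)]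

/-- The false discovery proportion of the knockoff procedure is at most `q` times the sum of the
weights of the nulls with a positive statistic. -/
lemma fdp_selected_le {q : ℝ} (hq : 0 ≤ q) (S₀ : Finset (Fin p)) (W : Fin p → ℝ) :
    fdp (selected q W) S₀ ≤ q * ∑ j ∈ S₀, if 0 < W j then looWeight q S₀ W j else 0 := by
  classical
  have hnn : ∀ j, 0 ≤ if 0 < W j then looWeight q S₀ W j else 0 := fun j => by
    split_ifs
    exacts [looWeight_nonneg _ _ _ _, le_rfl]
  rcases threshold_eq_top_or_attained q W with h | ⟨t, h, ht, hq'⟩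
  · have : selected q W = ∅ := by simp [selected, h]
    rw [this]
    simpa [fdp] using mul_nonneg hq (Finset.sum_nonneg fun j _ => hnn j)
  have ht0 := pos_of_mem_range_abs ht
  set N : ℝ := ((Finset.univ.filter fun j => W j ≤ -t).card : ℝ) with hN
  have hN0 : 0 ≤ N := by positivity
  have hsel : selected q W = Finset.univ.filter fun j => t ≤ W j := by
    ext j; simp [selected, h]
  set R : ℝ := max (((selected q W).card : ℕ) : ℝ) 1 with hR
  have hR0 : 0 < R := lt_max_of_lt_right one_pos
  have hqR : (1 + N) / R ≤ q := by simpa [fdpHat, hN, hR, hsel] using hq'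
  -- A selected null has a positive statistic, so its leave-one-out threshold is `t` itself. Its
  -- weight is at least `(1 + N)⁻¹`, since `N` counts all features and the weight only nulls.
  have hsum : (((selected q W ∩ S₀).card : ℕ) : ℝ) * (1 + N)⁻¹ ≤
      ∑ j ∈ S₀, if 0 < W j then looWeight q S₀ W j else 0 := by
    rw [← nsmul_eq_mul]
    refine (Finset.card_nsmul_le_sum _ _ _ fun j hj => ?_).trans
      (Finset.sum_le_sum_of_subset_of_nonneg Finset.inter_subset_right fun j _ _ => hnn j)
    have hj' : t ≤ W j := by
      have := (Finset.mem_inter.1 hj).1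
      rw [hsel] at this
      simpa using this
    have hj0 : 0 < W j := ht0.trans_le hj'
    rw [if_pos hj0, looWeight, absAt_of_nonneg hj0.le, h, if_pos (by
      rw [abs_of_pos hj0]; exact_mod_cast hj')]
    refine inv_anti₀ (by positivity) ?_
    refine add_le_add_right (Nat.cast_le.2 (Finset.card_le_card fun k hk => ?_)) _
    have := (Finset.mem_filter.1 hk).2
    have : t ≤ -W k := by exact_mod_cast this
    simp; linarith
  calc fdp (selected q W) S₀
      = (1 + N) / R * ((((selected q W ∩ S₀).card : ℕ) : ℝ) * (1 + N)⁻¹) := by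
        rw [fdp, ← hR]; field_simp
    _ ≤ _ := by gcongr

/-- Flipping `j` moves one index from the negative to the positive count. The right side does not
depend on which `j` with `W j ≤ -t` is flipped, as `threshold_absAt_le` requires. -/
lemma fdpHat_absAt {W : Fin p → ℝ} {t : ℝ} (ht : 0 < t) {j : Fin p} (hj : W j ≤ -t) :
    fdpHat (absAt W j) t =
      (1 + (((Finset.univ.filter fun k => W k ≤ -t).card - 1 : ℕ) : ℝ)) /
        max (((Finset.univ.filter fun k => t ≤ W k).card + 1 : ℕ) : ℝ) 1 := by
  classical
  have habs : |W j| = -W j := abs_of_nonpos (by linarith)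
  have h1 : (Finset.univ.filter fun k => absAt W j k ≤ -t) =
      (Finset.univ.filter fun k => W k ≤ -t).erase j := by
    ext k
    simp only [Finset.mem_filter, Finset.mem_univ, true_and, Finset.mem_erase]
    rcases eq_or_ne k j with rfl | hk
    · simp [absAt, habs]; linarith
    · simp [absAt, hk]
  have h2 : (Finset.univ.filter fun k => t ≤ absAt W j k) =
      insert j (Finset.univ.filter fun k => t ≤ W k) := by
    ext k
    simp only [Finset.mem_filter, Finset.mem_univ, true_and, Finset.mem_insert]
    rcases eq_or_ne k j with rfl | hk
    · simp [absAt, habs]; linarith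
    · simp [absAt, hk]
  rw [fdpHat, h1, h2, Finset.card_erase_of_mem (by simpa using hj),
    Finset.card_insert_of_notMem (by simp; linarith)]

/-- If the threshold `t` for `k` is the smaller one, both `j` and `k` lie below `-t`, so flipping
either gives the same `fdpHat` at `t`. Hence `t` is admissible for `j` too. -/
lemma threshold_absAt_le {q : ℝ} {W : Fin p → ℝ} {j k : Fin p}
    (hTj : threshold q (absAt W j) ≤ ((-W j : ℝ) : EReal))
    (hTk : threshold q (absAt W k) ≤ ((-W k : ℝ) : EReal)) :
    threshold q (absAt W j) ≤ ((-W k : ℝ) : EReal) := by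
  rcases le_total (threshold q (absAt W j)) (threshold q (absAt W k)) with h | h
  · exact h.trans hTk
  refine le_trans ?_ hTk
  rcases threshold_eq_top_or_attained q (absAt W k) with h' | ⟨t, h', ht, hq⟩
  · simp [h']
  rw [h'] at hTk h ⊢
  have ht0 := pos_of_mem_range_abs ht
  have htk : t ≤ -W k := by exact_mod_cast hTk
  have htj : t ≤ -W j := by exact_mod_cast h.trans hTj
  refine threshold_le ?_ ?_
  · simpa only [abs_absAt] using ht
  · rwa [fdpHat_absAt ht0 (by linarith : W j ≤ -t),
      ← fdpHat_absAt ht0 (by linarith : W k ≤ -t)]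

/-- The weights of the nulls with a negative statistic sum to at most `1`. -/
lemma sum_looWeight_neg_le_one (q : ℝ) (S₀ : Finset (Fin p)) (W : Fin p → ℝ) :
    ∑ j ∈ S₀, (if W j < 0 then looWeight q S₀ W j else 0) ≤ 1 := by
  classical
  set A := S₀.filter fun j => W j < 0 ∧ threshold q (absAt W j) ≤ ((-W j : ℝ) : EReal) with hA
  -- By `threshold_absAt_le`, the denominator of the weight of `j ∈ A` counts every other element of
  -- `A`, and the added 1 accounts for `j`.
  have hle : ∀ j ∈ S₀, (if W j < 0 then looWeight q S₀ W j else 0) ≤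
      if j ∈ A then (A.card : ℝ)⁻¹ else 0 := by
    intro j hjS
    by_cases hj : W j < 0
    swap
    · rw [if_neg hj]; split_ifs <;> positivity
    rw [if_pos hj, looWeight, abs_of_neg hj]
    by_cases hT : threshold q (absAt W j) ≤ ((-W j : ℝ) : EReal)
    swap
    · rw [if_neg hT]; split_ifs <;> positivity
    have hjA : j ∈ A := Finset.mem_filter.2 ⟨hjS, hj, hT⟩
    rw [if_pos hT, if_pos hjA]
    refine inv_anti₀ (by exact_mod_cast Finset.card_pos.2 ⟨j, hjA⟩) ?_
    rw [← Finset.card_erase_add_one hjA, add_comm]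
    push_cast
    gcongr
    intro k hk
    obtain ⟨hkj, hkA⟩ := Finset.mem_erase.1 hk
    obtain ⟨hkS, -, hkT⟩ := Finset.mem_filter.1 hkA
    exact Finset.mem_filter.2 ⟨Finset.mem_erase.2 ⟨hkj, hkS⟩, threshold_absAt_le hT hkT⟩
  refine (Finset.sum_le_sum hle).trans ?_
  rw [← Finset.sum_filter, Finset.filter_mem_eq_inter,
    Finset.inter_eq_right.2 (Finset.filter_subset _ _), Finset.sum_const, nsmul_eq_mul]
  exact mul_inv_le_one

/-! ### Measurability -/

lemma measurable_card_filter {α ι : Type*} [MeasurableSpace α] (S : Finset ι) (r : ι → α → Prop)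
    [∀ x, DecidablePred fun i => r i x] (hr : ∀ i, MeasurableSet {x | r i x}) :
    Measurable fun x => ((S.filter fun i => r i x).card : ℝ) := by
  classical
  simp only [Finset.card_filter, Nat.cast_sum, Nat.cast_ite, Nat.cast_one, Nat.cast_zero]
  refine Finset.measurable_sum _ fun i _ => ?_
  convert! Measurable.ite (hr i) (measurable_const (a := (1 : ℝ))) (measurable_const (a := (0 : ℝ)))

lemma measurable_fdpHat {α : Type*} [MeasurableSpace α] {V : α → Fin p → ℝ} {t : α → ℝ}
    (hV : Measurable V) (ht : Measurable t) : Measurable fun x => fdpHat (V x) (t x) := by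
  have hV' : ∀ j, Measurable fun x => V x j := fun j => (measurable_pi_apply j).comp hV
  unfold fdpHat
  refine Measurable.div (measurable_const.add ?_) (Measurable.max ?_ measurable_const)
  · exact measurable_card_filter _ (fun j x => V x j ≤ -t x)
      fun j => measurableSet_le (hV' j) ht.neg
  · exact measurable_card_filter _ (fun j x => t x ≤ V x j)
      fun j => measurableSet_le ht (hV' j)

open Classical in
-- An infimum over the fixed index set `Fin p`, instead of a set that varies with `W`, makes
-- measurability in `W` accessible.
lemma threshold_eq_iInf (q : ℝ) (W : Fin p → ℝ) :
    threshold q W =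
      ⨅ i, if |W i| ≠ 0 ∧ fdpHat W |W i| ≤ q then ((|W i| : ℝ) : EReal) else ⊤ := by
  apply le_antisymm
  · refine le_iInf fun i => ?_
    split_ifs with h
    · exact threshold_le ⟨⟨i, rfl⟩, h.1⟩ h.2
    · exact le_top
  · refine le_sInf ?_
    rintro _ ⟨t, ⟨⟨⟨i, rfl⟩, h0⟩, h⟩, rfl⟩
    refine (iInf_le _ i).trans ?_
    rw [if_pos ⟨h0, h⟩]

lemma measurable_threshold (q : ℝ) : Measurable (threshold q : (Fin p → ℝ) → EReal) := by
  classical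
  have : (threshold q : (Fin p → ℝ) → EReal) = fun W =>
      ⨅ i, if |W i| ≠ 0 ∧ fdpHat W |W i| ≤ q then ((|W i| : ℝ) : EReal) else ⊤ :=
    funext (threshold_eq_iInf q)
  rw [this]
  refine Measurable.iInf fun i => ?_
  have habs : Measurable fun W : Fin p → ℝ => |W i| := by fun_prop
  refine Measurable.ite (MeasurableSet.inter ?_ ?_) habs.coe_real_ereal measurable_const
  · exact (measurableSet_eq_fun habs measurable_const).compl
  · exact measurableSet_le (measurable_fdpHat measurable_id habs) measurable_const

lemma measurable_looWeight (q : ℝ) (S₀ : Finset (Fin p)) (j : Fin p) :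
    Measurable fun W : Fin p → ℝ => looWeight q S₀ W j := by
  classical
  have habs : Measurable fun W : Fin p → ℝ => |W j| := by fun_prop
  have hT : Measurable fun W : Fin p → ℝ => threshold q (absAt W j) := by
    refine (measurable_threshold q).comp (measurable_pi_lambda _ fun i => ?_)
    rcases eq_or_ne i j with rfl | h
    · simpa [absAt] using habs
    · simpa [absAt, h] using measurable_pi_apply i
  unfold looWeight
  refine Measurable.ite (measurableSet_le hT habs.coe_real_ereal)
    (measurable_const.add ?_).inv measurable_const
  exact measurable_card_filter _ (fun k W => threshold q (absAt W j) ≤ ((-W k : ℝ) : EReal))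
    fun k => measurableSet_le hT (measurable_pi_apply k).neg.coe_real_ereal

/-! ### Reflection of Gaussian variables -/

lemma gaussianPDF_neg_le {m x : ℝ} (hm : 0 ≤ m) (hx : 0 ≤ x) (v : NNReal) :
    gaussianPDF m v (-x) ≤ gaussianPDF m v x := by
  unfold gaussianPDF gaussianPDFReal
  have : (x - m) ^ 2 ≤ (-x - m) ^ 2 := by nlinarith [mul_nonneg hm hx]
  gcongr

/-- A Gaussian variable with nonnegative mean gives a negative half-line at most the weight of the
opposite positive one. -/
lemma setLIntegral_Iio_le_setLIntegral_Ioi_gaussianReal {m : ℝ} (hm : 0 ≤ m) (v : NNReal)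
    {f : ℝ → ENNReal} (hf : Measurable f) (heven : ∀ x, f (-x) = f x) :
    ∫⁻ x in Set.Iio 0, f x ∂gaussianReal m v ≤ ∫⁻ x in Set.Ioi 0, f x ∂gaussianReal m v := by
  -- With zero variance the law is a point mass at `m ≥ 0`, which does not charge the negative
  -- half-line.
  rcases eq_or_ne v 0 with rfl | hv
  · rw [gaussianReal_zero_var, Measure.restrict_eq_zero.2 (by simpa using hm)]
    simp
  have hpdf := measurable_gaussianPDF m v
  rw [gaussianReal_of_var_ne_zero _ hv,
    setLIntegral_withDensity_eq_setLIntegral_mul _ hpdf hf measurableSet_Iio,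
    setLIntegral_withDensity_eq_setLIntegral_mul _ hpdf hf measurableSet_Ioi]
  have hneg : MeasurePreserving (fun x : ℝ => -x) (volume.restrict (Set.Ioi 0))
      (volume.restrict (Set.Iio 0)) := by
    have := (Measure.measurePreserving_neg (volume : Measure ℝ)).restrict_preimage
      (measurableSet_Iio (a := (0 : ℝ)))
    simpa using this
  rw [← hneg.lintegral_comp (hpdf.mul hf)]
  refine setLIntegral_mono (hpdf.mul hf) fun x hx => ?_
  simp only [Pi.mul_apply, heven]
  gcongr
  exact gaussianPDF_neg_le hm (le_of_lt hx) v

/-- By independence and Fubini, the one-dimensional reflection inequality applies for each fixed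
value of `Z`. -/
lemma lintegral_neg_le_lintegral_pos_of_indepFun {Ω E : Type*} [MeasurableSpace Ω]
    [MeasurableSpace E] {P : Measure Ω} [IsProbabilityMeasure P] {D : Ω → ℝ} {Z : Ω → E} {m : ℝ}
    (hm : 0 ≤ m) {v : NNReal} (hD : HasLaw D (gaussianReal m v) P) (hZ : AEMeasurable Z P)
    (hDZ : IndepFun D Z P) {H : ℝ → E → ENNReal} (hH : Measurable (Function.uncurry H))
    (heven : ∀ d z, H (-d) z = H d z) :
    ∫⁻ ω, (if D ω < 0 then H (D ω) (Z ω) else 0) ∂P ≤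
      ∫⁻ ω, (if 0 < D ω then H (D ω) (Z ω) else 0) ∂P := by
  have hZlaw : HasLaw Z (P.map Z) P := ⟨hZ, rfl⟩
  have : IsProbabilityMeasure (P.map Z) := Measure.isProbabilityMeasure_map hZ
  have hlaw := (indepFun_iff_hasLaw_prodMk_prod hD hZlaw).1 hDZ
  have h1 : Measurable fun x : ℝ × E => if x.1 < 0 then H x.1 x.2 else 0 :=
    Measurable.ite (measurableSet_lt measurable_fst measurable_const) hH measurable_const
  have h2 : Measurable fun x : ℝ × E => if 0 < x.1 then H x.1 x.2 else 0 :=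
    Measurable.ite (measurableSet_lt measurable_const measurable_fst) hH measurable_const
  rw [hlaw.lintegral_comp h1.aemeasurable, hlaw.lintegral_comp h2.aemeasurable,
    lintegral_prod_symm _ h1.aemeasurable, lintegral_prod_symm _ h2.aemeasurable]
  refine lintegral_mono fun z => ?_
  have := setLIntegral_Iio_le_setLIntegral_Ioi_gaussianReal hm v
    (f := fun d => H d z) (hH.comp (measurable_id.prodMk measurable_const)) fun d => heven d z
  rw [← lintegral_indicator measurableSet_Iio, ← lintegral_indicator measurableSet_Ioi] at this
  simpa [Set.indicator_apply] using this

/-! ### Linear images of Gaussian noise -/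

section Noise

variable {Ω : Type*} [MeasurableSpace Ω] {P : Measure Ω} {noise : Ω → Fin n → ℝ} {v : NNReal}

lemma hasLaw_noise_apply (h : HasLaw noise (Measure.pi fun _ : Fin n => gaussianReal 0 v) P)
    (i : Fin n) : HasLaw (fun ω => noise ω i) (gaussianReal 0 v) P :=
  (measurePreserving_eval (fun _ : Fin n => gaussianReal 0 v) i).fun_comp_hasLaw h

variable [IsProbabilityMeasure P]

lemma iIndepFun_noise (h : HasLaw noise (Measure.pi fun _ : Fin n => gaussianReal 0 v) P) :
    iIndepFun (fun i ω => noise ω i) P :=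
  (iIndepFun_iff_hasLaw_pi_pi (hasLaw_noise_apply h)).2 h

lemma hasGaussianLaw_noise
    (h : HasLaw noise (Measure.pi fun _ : Fin n => gaussianReal 0 v) P) :
    HasGaussianLaw noise P :=
  (iIndepFun_noise h).hasGaussianLaw fun i => (hasLaw_noise_apply h i).hasGaussianLaw

lemma covariance_dotProduct_noise
    (h : HasLaw noise (Measure.pi fun _ : Fin n => gaussianReal 0 v) P) (a b : Fin n → ℝ) :
    cov[fun ω => a ⬝ᵥ noise ω, fun ω => b ⬝ᵥ noise ω; P] = v * (a ⬝ᵥ b) := by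
  have hL : ∀ i, MemLp (fun ω => noise ω i) 2 P := fun i =>
    (hasLaw_noise_apply h i).hasGaussianLaw.memLp_two
  have hcov : ∀ i j,
      cov[fun ω => noise ω i, fun ω => noise ω j; P] = if i = j then (v : ℝ) else 0 := by
    intro i j
    split_ifs with hij
    · subst hij
      rw [covariance_self (hL i).aemeasurable, (hasLaw_noise_apply h i).variance_eq]
      simp
    · exact ((iIndepFun_noise h).indepFun hij).covariance_eq_zero (hL i) (hL j)
  simp only [dotProduct]
  rw [covariance_fun_sum_fun_sum (fun i => (hL i).const_mul (a i)) fun i => (hL i).const_mul (b i)]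
  simp only [covariance_const_mul_left, covariance_const_mul_right, hcov, mul_ite, mul_zero,
    Finset.sum_ite_eq, Finset.mem_univ, if_true, Finset.mul_sum]
  exact Finset.sum_congr rfl fun i _ => by ring

lemma hasLaw_dotProduct_noise
    (h : HasLaw noise (Measure.pi fun _ : Fin n => gaussianReal 0 v) P) (a : Fin n → ℝ) :
    ∃ v' : NNReal, HasLaw (fun ω => a ⬝ᵥ noise ω) (gaussianReal 0 v') P := by
  have hg : HasGaussianLaw (fun ω => a ⬝ᵥ noise ω) P :=
    (hasGaussianLaw_noise h).map_fun (LinearMap.toContinuousLinearMap (dotProductBilin ℝ ℝ a))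
  have hmean : P[fun ω => a ⬝ᵥ noise ω] = 0 := by
    simp only [dotProduct]
    rw [integral_finsetSum _ fun i _ =>
      ((hasLaw_noise_apply h i).hasGaussianLaw.integrable).const_mul _]
    refine Finset.sum_eq_zero fun i _ => ?_
    rw [integral_const_mul, (hasLaw_noise_apply h i).integral_eq]
    simp
  exact ⟨_, hg.aemeasurable, by rw [hg.map_eq_gaussianReal, hmean]⟩

/-- The pair is jointly Gaussian and its cross-covariance is a multiple of `M *ᵥ a`, so
uncorrelatedness gives independence. -/
lemma indepFun_dotProduct_mulVec_noise {ι : Type*} [Finite ι]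
    (h : HasLaw noise (Measure.pi fun _ : Fin n => gaussianReal 0 v) P) (a : Fin n → ℝ)
    (M : Matrix ι (Fin n) ℝ) (hM : M *ᵥ a = 0) :
    IndepFun (fun ω => a ⬝ᵥ noise ω) (fun ω => M *ᵥ noise ω) P := by
  have := Fintype.ofFinite ι
  have hg : HasGaussianLaw (fun ω => ((fun _ : Unit => a ⬝ᵥ noise ω), M *ᵥ noise ω)) P :=
    (hasGaussianLaw_noise h).map_fun (LinearMap.toContinuousLinearMap
      ((LinearMap.pi fun _ : Unit => dotProductBilin ℝ ℝ a).prod M.mulVecLin))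
  have hi := HasGaussianLaw.indepFun_of_covariance_eval (X := fun (_ : Unit) ω => a ⬝ᵥ noise ω)
    (Y := fun i ω => (M *ᵥ noise ω) i) hg fun _ i => by
      simp only [mulVec]
      rw [covariance_dotProduct_noise h, dotProduct_comm]
      have := congrFun hM i
      simp only [mulVec, Pi.zero_apply] at this
      rw [this, mul_zero]
  exact hi.comp (measurable_pi_apply ()) measurable_id

end Noise

/-! ### The estimates and the swap of a feature with its knockoff -/

/-- The direction `e_j - ẽ_j` that compares feature `j` with its knockoff. -/
def swapDir (j : Fin p) : Fin p ⊕ Fin p → ℝ := Sum.elim (Pi.single j 1) (-Pi.single j 1)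

lemma swapDir_dotProduct (j : Fin p) (x : Fin p ⊕ Fin p → ℝ) :
    swapDir j ⬝ᵥ x = x (Sum.inl j) - x (Sum.inr j) := by
  simp [swapDir, dotProduct, Pi.single_apply, sub_eq_add_neg]

/-- The projection along `swapDir j` onto the vectors fixed by the swap at `j`. -/
def symmetrize (j : Fin p) (x : Fin p ⊕ Fin p → ℝ) : Fin p ⊕ Fin p → ℝ :=
  x - ((x (Sum.inl j) - x (Sum.inr j)) / 2) • swapDir j

lemma symmetrize_add_smul_comp_swap (j : Fin p) (x : Fin p ⊕ Fin p → ℝ) (t : ℝ) :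
    (symmetrize j x + t • swapDir j) ∘ Equiv.swap (Sum.inl j) (Sum.inr j) =
      symmetrize j x + (-t) • swapDir j := by
  funext i
  rcases i with k | k <;> rcases eq_or_ne k j with rfl | hk
  · simp [symmetrize, swapDir]; ring
  · simp [symmetrize, swapDir, hk, Equiv.swap_apply_of_ne_of_ne]
  · simp [symmetrize, swapDir]; ring
  · simp [symmetrize, swapDir, hk, Equiv.swap_apply_of_ne_of_ne]

lemma symmetrize_add_symmetrize (j : Fin p) (c x : Fin p ⊕ Fin p → ℝ) :
    symmetrize j (c + symmetrize j x) +
      (((c + x) (Sum.inl j) - (c + x) (Sum.inr j)) / 2) • swapDir j = c + x := by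
  have h1 : swapDir j (Sum.inl j) = 1 := by simp [swapDir]
  have h2 : swapDir j (Sum.inr j) = -1 := by simp [swapDir]
  funext i
  simp only [symmetrize, Pi.add_apply, Pi.sub_apply, Pi.smul_apply, smul_eq_mul, h1, h2]
  ring

lemma measurable_symmetrize (j : Fin p) : Measurable (symmetrize j) := by
  unfold symmetrize
  fun_prop

/-- The matrix that maps the response to the least-squares estimate. -/
def olsMatrix (X Xk : Matrix (Fin n) (Fin p) ℝ) : Matrix (Fin p ⊕ Fin p) (Fin n) ℝ :=
  (augGram X Xk)⁻¹ * (fromCols X Xk)ᵀ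

lemma olsEstimate_eq {X Xk : Matrix (Fin n) (Fin p) ℝ} (hG : IsUnit (augGram X Xk))
    (β : Fin p → ℝ) (ε : Fin n → ℝ) :
    olsEstimate X Xk (X *ᵥ β + ε) = Sum.elim β 0 + olsMatrix X Xk *ᵥ ε := by
  have hX : X *ᵥ β = fromCols X Xk *ᵥ Sum.elim β 0 := by simp [fromCols_mulVec]
  rw [olsEstimate, mulVec_mulVec, mulVec_add, hX, mulVec_mulVec, Matrix.mul_assoc]
  have : (augGram X Xk)⁻¹ * ((fromCols X Xk)ᵀ * fromCols X Xk) = 1 :=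
    nonsing_inv_mul _ ((isUnit_iff_isUnit_det _).1 hG)
  rw [this, one_mulVec, olsMatrix]

/-- The blocks of the Gram matrix differ only by `diagonal s`, so in the contrast of a feature with
its knockoff everything but `s j` cancels. -/
lemma augGram_mulVec_swapDir {X Xk : Matrix (Fin n) (Fin p) ℝ} {s : Fin p → ℝ}
    (hXk : IsKnockoffDesign X Xk s) (j : Fin p) :
    augGram X Xk *ᵥ swapDir j = s j • swapDir j := by
  rw [IsKnockoffDesign] at hXk
  rw [hXk, fromBlocks_mulVec]
  funext i
  rcases i with k | k <;> rcases eq_or_ne k j with rfl | hk <;>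
    simp [swapDir, mulVec_neg, *]
  ring

lemma exists_inv_augGram_mulVec_swapDir {X Xk : Matrix (Fin n) (Fin p) ℝ} {s : Fin p → ℝ}
    (hXk : IsKnockoffDesign X Xk s) (hG : IsUnit (augGram X Xk)) (j : Fin p) :
    ∃ c : ℝ, (augGram X Xk)⁻¹ *ᵥ swapDir j = c • swapDir j := by
  have h : s j • ((augGram X Xk)⁻¹ *ᵥ swapDir j) = swapDir j := by
    rw [← mulVec_smul, ← augGram_mulVec_swapDir hXk, mulVec_mulVec,
      nonsing_inv_mul _ ((isUnit_iff_isUnit_det _).1 hG), one_mulVec]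
  -- If `s j` were zero, invertibility of the Gram matrix would force `swapDir j = 0`.
  have hs : s j ≠ 0 := by
    intro hs
    have := congrFun h (Sum.inl j)
    simp [hs, swapDir] at this
  refine ⟨(s j)⁻¹, ?_⟩
  nth_rw 2 [← h]
  rw [smul_smul, inv_mul_cancel₀ hs, one_smul]

lemma olsMatrix_mul_transpose {X Xk : Matrix (Fin n) (Fin p) ℝ} (hG : IsUnit (augGram X Xk)) :
    olsMatrix X Xk * (olsMatrix X Xk)ᵀ = (augGram X Xk)⁻¹ := by
  have hsymm : (augGram X Xk)ᵀ = augGram X Xk := by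
    rw [augGram, transpose_mul, transpose_transpose]
  rw [olsMatrix, transpose_mul, transpose_transpose, transpose_nonsing_inv, hsymm,
    Matrix.mul_assoc, ← Matrix.mul_assoc _ (fromCols X Xk)]
  change _ * (augGram X Xk * _) = _
  rw [mul_nonsing_inv _ ((isUnit_iff_isUnit_det _).1 hG), Matrix.mul_one]

/-- The difference of the `j`-th estimate and its knockoff is independent of the symmetrized
vector of estimates. -/
lemma indepFun_swapDir_symmetrize {Ω : Type*} [MeasurableSpace Ω] {P : Measure Ω}
    [IsProbabilityMeasure P] {X Xk : Matrix (Fin n) (Fin p) ℝ} {s : Fin p → ℝ}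
    (hXk : IsKnockoffDesign X Xk s) (hG : IsUnit (augGram X Xk)) {noise : Ω → Fin n → ℝ}
    {v : NNReal} (h : HasLaw noise (Measure.pi fun _ : Fin n => gaussianReal 0 v) P) (j : Fin p) :
    IndepFun (fun ω => (swapDir j ᵥ* olsMatrix X Xk) ⬝ᵥ noise ω)
      (fun ω => symmetrize j (olsMatrix X Xk *ᵥ noise ω)) P := by
  set L := olsMatrix X Xk with hL
  have hM : ∀ x, (L - (2⁻¹ : ℝ) • vecMulVec (swapDir j) (swapDir j ᵥ* L)) *ᵥ x =
      symmetrize j (L *ᵥ x) := by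
    intro x
    rw [sub_mulVec, smul_mulVec, vecMulVec_mulVec, ← dotProduct_mulVec, swapDir_dotProduct,
      symmetrize]
    congr 1
    funext i
    simp
    ring
  have key := indepFun_dotProduct_mulVec_noise h (swapDir j ᵥ* L)
    (L - (2⁻¹ : ℝ) • vecMulVec (swapDir j) (swapDir j ᵥ* L)) (by
      obtain ⟨c, hc⟩ := exists_inv_augGram_mulVec_swapDir hXk hG j
      -- The covariance reduces to `symmetrize j` of G⁻¹ applied to `swapDir j`, a multiple of
      -- `swapDir j`, which `symmetrize j` kills.
      rw [hM, ← mulVec_transpose, mulVec_mulVec, hL, olsMatrix_mul_transpose hG, hc]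
      funext i
      simp [symmetrize, swapDir])
  simpa only [hM] using key

/-- If the `j`-th estimate has at least the mean of its knockoff, the region where it is smaller
contributes at most as much as the region where it is larger to the integral of a function
invariant under the swap of the two. -/
lemma lintegral_lt_le_lintegral_gt {Ω : Type*} [MeasurableSpace Ω] {P : Measure Ω}
    [IsProbabilityMeasure P] {X Xk : Matrix (Fin n) (Fin p) ℝ} {s : Fin p → ℝ}
    (hXk : IsKnockoffDesign X Xk s) (hG : IsUnit (augGram X Xk)) {noise : Ω → Fin n → ℝ}
    {v : NNReal} (h : HasLaw noise (Measure.pi fun _ : Fin n => gaussianReal 0 v) P)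
    {j : Fin p} {c : Fin p ⊕ Fin p → ℝ} (hc : c (Sum.inr j) ≤ c (Sum.inl j))
    {F : (Fin p ⊕ Fin p → ℝ) → ENNReal} (hF : Measurable F)
    (hswap : ∀ z, F (z ∘ Equiv.swap (Sum.inl j) (Sum.inr j)) = F z)
    {z : Ω → Fin p ⊕ Fin p → ℝ} (hz : ∀ ω, z ω = c + olsMatrix X Xk *ᵥ noise ω) :
    ∫⁻ ω, (if z ω (Sum.inl j) < z ω (Sum.inr j) then F (z ω) else 0) ∂P ≤
      ∫⁻ ω, (if z ω (Sum.inr j) < z ω (Sum.inl j) then F (z ω) else 0) ∂P := by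
  set L := olsMatrix X Xk with hL
  have hd : ∀ ω, (c (Sum.inl j) - c (Sum.inr j)) + (swapDir j ᵥ* L) ⬝ᵥ noise ω =
      z ω (Sum.inl j) - z ω (Sum.inr j) := by
    intro ω
    rw [← dotProduct_mulVec, swapDir_dotProduct, hz]
    simp only [Pi.add_apply]
    ring
  have hLm : Measurable fun x : Fin n → ℝ => L *ᵥ x :=
    (LinearMap.continuous_of_finiteDimensional L.mulVecLin).measurable
  obtain ⟨v', hv'⟩ := hasLaw_dotProduct_noise h (swapDir j ᵥ* L)
  have hD := gaussianReal_const_add hv' (c (Sum.inl j) - c (Sum.inr j))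
  have hind := (indepFun_swapDir_symmetrize hXk hG h j).comp
    (measurable_const_add (c (Sum.inl j) - c (Sum.inr j))) measurable_id
  have key := lintegral_neg_le_lintegral_pos_of_indepFun (P := P)
    (m := 0 + (c (Sum.inl j) - c (Sum.inr j))) (by linarith) hD
    (((measurable_symmetrize j).comp hLm).comp_aemeasurable h.aemeasurable) hind
    -- The estimates are rebuilt from their difference `d` and symmetric part; the swap at `j`
    -- becomes `d ↦ -d`, so `H` is even in `d`.
    (H := fun d x => F (symmetrize j (c + x) + (d / 2) • swapDir j)) (by
      refine hF.comp (Measurable.add ?_ ?_)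
      · exact (measurable_symmetrize j).comp (measurable_const.add measurable_snd)
      · exact (measurable_fst.div_const 2).smul_const _)
    fun d x => by
      rw [← hswap, symmetrize_add_smul_comp_swap]
      congr 3; ring
  have hrec : ∀ ω, symmetrize j (c + symmetrize j (L *ᵥ noise ω)) +
      ((z ω (Sum.inl j) - z ω (Sum.inr j)) / 2) • swapDir j = z ω := by
    intro ω
    rw [hz]
    exact symmetrize_add_symmetrize j c _
  simpa only [Function.comp_def, id, hd, hrec, sub_neg, sub_pos] using key

/-! ### Antisymmetric statistics -/

lemma IsAntisymmetric.comp_swap {w : (Fin p → ℝ) → (Fin p → ℝ) → Fin p → ℝ}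
    (hw : IsAntisymmetric w) (z : Fin p ⊕ Fin p → ℝ) (j : Fin p) :
    w ((z ∘ Equiv.swap (Sum.inl j) (Sum.inr j)) ∘ Sum.inl)
        ((z ∘ Equiv.swap (Sum.inl j) (Sum.inr j)) ∘ Sum.inr) =
      Function.update (w (z ∘ Sum.inl) (z ∘ Sum.inr)) j (-w (z ∘ Sum.inl) (z ∘ Sum.inr) j) := by
  have h1 : (z ∘ Equiv.swap (Sum.inl j) (Sum.inr j)) ∘ Sum.inl =
      ({j} : Finset (Fin p)).piecewise (z ∘ Sum.inr) (z ∘ Sum.inl) := by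
    funext k
    rcases eq_or_ne k j with rfl | hk <;> simp [*, Equiv.swap_apply_of_ne_of_ne]
  have h2 : (z ∘ Equiv.swap (Sum.inl j) (Sum.inr j)) ∘ Sum.inr =
      ({j} : Finset (Fin p)).piecewise (z ∘ Sum.inl) (z ∘ Sum.inr) := by
    funext k
    rcases eq_or_ne k j with rfl | hk <;> simp [*, Equiv.swap_apply_of_ne_of_ne]
  rw [h1, h2]
  funext i
  rw [hw]
  rcases eq_or_ne i j with rfl | hi <;> simp [*]

/-- `|b| < |a|` means `(a - b) * (a + b) > 0`, so a nonpositive sum forces a negative difference. -/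
lemma lt_of_sign_eq_of_add_nonpos {x a b : ℝ}
    (h : SignType.sign x = SignType.sign (|a| - |b|)) (hx : 0 < x) (hab : a + b ≤ 0) : a < b := by
  have h' : |b| < |a| := by
    rw [sign_pos hx] at h
    exact sub_pos.1 (sign_eq_one_iff.1 h.symm)
  rw [← sq_lt_sq] at h'
  nlinarith

/-- The event that no null has a positive sum of estimates. -/
def nonposSums (S₀ : Finset (Fin p)) : Set (Fin p ⊕ Fin p → ℝ) :=
  {z | ∀ k ∈ S₀, z (Sum.inl k) + z (Sum.inr k) ≤ 0}

lemma measurableSet_nonposSums (S₀ : Finset (Fin p)) : MeasurableSet (nonposSums S₀) := by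
  have : nonposSums S₀ = ⋂ k ∈ S₀, {z | z (Sum.inl k) + z (Sum.inr k) ≤ 0} := by
    ext z; simp [nonposSums]
  rw [this]
  exact Finset.measurableSet_biInter _ fun k _ =>
    measurableSet_le (by fun_prop) measurable_const

lemma comp_swap_mem_nonposSums (S₀ : Finset (Fin p)) (z : Fin p ⊕ Fin p → ℝ) (j : Fin p) :
    z ∘ Equiv.swap (Sum.inl j) (Sum.inr j) ∈ nonposSums S₀ ↔ z ∈ nonposSums S₀ := by
  refine forall₂_congr fun k _ => ?_
  rcases eq_or_ne k j with rfl | hk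
  · simp [add_comm]
  · simp [hk, Equiv.swap_apply_of_ne_of_ne]

/-- On the event `nonposSums S₀`, a null is at most as likely to have a positive statistic as to
have a negative one, given its leave-one-out weight. -/
lemma lintegral_looWeight_pos_le {Ω : Type*} [MeasurableSpace Ω] {P : Measure Ω}
    [IsProbabilityMeasure P] {X Xk : Matrix (Fin n) (Fin p) ℝ} {s : Fin p → ℝ}
    (hXk : IsKnockoffDesign X Xk s) (hG : IsUnit (augGram X Xk)) {noise : Ω → Fin n → ℝ}
    {v : NNReal} (h : HasLaw noise (Measure.pi fun _ : Fin n => gaussianReal 0 v) P)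
    {w : (Fin p → ℝ) → (Fin p → ℝ) → Fin p → ℝ} (hw_meas : Measurable (Function.uncurry w))
    (hw_anti : IsAntisymmetric w)
    (hw_sign : ∀ (a b : Fin p → ℝ) (j : Fin p),
      SignType.sign (w a b j) = SignType.sign (|a j| - |b j|))
    (q : ℝ) {S₀ : Finset (Fin p)} {j : Fin p} (hj : j ∈ S₀)
    {c : Fin p ⊕ Fin p → ℝ} (hc : c (Sum.inr j) ≤ c (Sum.inl j))
    {z : Ω → Fin p ⊕ Fin p → ℝ} (hz : ∀ ω, z ω = c + olsMatrix X Xk *ᵥ noise ω)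
    {W : Ω → Fin p → ℝ} (hW : ∀ ω, W ω = w (z ω ∘ Sum.inl) (z ω ∘ Sum.inr)) :
    ∫⁻ ω, (z ⁻¹' nonposSums S₀).indicator
        (fun ω => ENNReal.ofReal (if 0 < W ω j then looWeight q S₀ (W ω) j else 0)) ω ∂P ≤
      ∫⁻ ω, ENNReal.ofReal (if W ω j < 0 then looWeight q S₀ (W ω) j else 0) ∂P := by
  set F : (Fin p ⊕ Fin p → ℝ) → ENNReal := (nonposSums S₀).indicator fun x =>
    ENNReal.ofReal (looWeight q S₀ (w (x ∘ Sum.inl) (x ∘ Sum.inr)) j) with hFdef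
  have hF : Measurable F := by
    refine Measurable.indicator ?_ (measurableSet_nonposSums S₀)
    refine ((measurable_looWeight q S₀ j).comp
      (hw_meas.comp (Measurable.prodMk ?_ ?_))).ennreal_ofReal
    · exact measurable_pi_lambda _ fun k => measurable_pi_apply _
    · exact measurable_pi_lambda _ fun k => measurable_pi_apply _
  have hswap : ∀ x, F (x ∘ Equiv.swap (Sum.inl j) (Sum.inr j)) = F x := by
    classical
    intro x
    simp only [hFdef, Set.indicator_apply, comp_swap_mem_nonposSums, hw_anti.comp_swap,
      looWeight_update_neg]
  have hpos : ∀ ω, z ω ∈ nonposSums S₀ → 0 < W ω j → z ω (Sum.inl j) < z ω (Sum.inr j) := by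
    intro ω hmem hpos
    have hs := hw_sign (z ω ∘ Sum.inl) (z ω ∘ Sum.inr) j
    rw [← hW] at hs
    exact lt_of_sign_eq_of_add_nonpos hs hpos (hmem j hj)
  refine le_trans (lintegral_mono fun ω => ?_)
    ((lintegral_lt_le_lintegral_gt hXk hG h hc hF hswap hz).trans (lintegral_mono fun ω => ?_))
  · by_cases hmem : z ω ∈ nonposSums S₀
    · rw [Set.indicator_of_mem (show ω ∈ z ⁻¹' nonposSums S₀ from hmem)]
      by_cases h0 : 0 < W ω j
      · rw [if_pos h0, if_pos (hpos ω hmem h0), hFdef, Set.indicator_of_mem hmem, hW]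
      · simp [h0]
    · rw [Set.indicator_of_notMem (show ω ∉ z ⁻¹' nonposSums S₀ from hmem)]
      exact zero_le
  · by_cases hlt : z ω (Sum.inr j) < z ω (Sum.inl j)
    swap
    · rw [if_neg hlt]; exact zero_le
    rw [if_pos hlt]
    by_cases hmem : z ω ∈ nonposSums S₀
    swap
    · rw [hFdef, Set.indicator_of_notMem hmem]; exact zero_le
    rw [hFdef, Set.indicator_of_mem hmem, ← hW]
    rcases lt_trichotomy (W ω j) 0 with h0 | h0 | h0
    · rw [if_pos h0]
    · simp [looWeight_of_eq_zero h0]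
    · exact absurd (hpos ω hmem h0) hlt.not_gt

lemma fdp_nonneg (S S₀ : Finset (Fin p)) : 0 ≤ fdp S S₀ := by
  unfold fdp; positivity

lemma fdp_le_one (S S₀ : Finset (Fin p)) : fdp S S₀ ≤ 1 := by
  refine div_le_one_of_le₀ (le_max_of_le_left ?_) (by positivity)
  exact_mod_cast Finset.card_le_card Finset.inter_subset_left

end FixedXKnockoff

end

theorem mainTheorem2 {Ω : Type*} [MeasurableSpace Ω] (P : Measure Ω) [IsProbabilityMeasure P]
    (n p : ℕ) (X Xk : Matrix (Fin n) (Fin p) ℝ) (s : Fin p → ℝ)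
    (hXk : FixedXKnockoff.IsKnockoffDesign X Xk s)
    (hG : IsUnit (FixedXKnockoff.augGram X Xk))
    (β : Fin p → ℝ) (σ : ℝ) (hσ : 0 < σ)
    (noise y : Ω → Fin n → ℝ)
    (hnoise : HasLaw noise (Measure.pi fun _ : Fin n => gaussianReal 0 (σ ^ 2).toNNReal) P)
    (hy : ∀ ω, y ω = X *ᵥ β + noise ω)
    (δ : ℝ) (hδ : 0 ≤ δ) (shift : Fin p → ℝ) (hshift : ∀ j, shift j ≤ -δ)
    (w : (Fin p → ℝ) → (Fin p → ℝ) → Fin p → ℝ)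
    (hw_meas : Measurable (Function.uncurry w))
    (hw_anti : FixedXKnockoff.IsAntisymmetric w)
    (hw_sign : ∀ (a b : Fin p → ℝ) (j : Fin p),
      SignType.sign (w a b j) = SignType.sign (|a j| - |b j|))
    (q : ℝ) (hq0 : 0 ≤ q) (hq1 : q ≤ 1) :
    FixedXKnockoff.FDR P
        (fun ω => FixedXKnockoff.selected q
          (w (FixedXKnockoff.solsOriginal X Xk (y ω))
            (FixedXKnockoff.solsKnockoff X Xk shift (y ω))))
        (FixedXKnockoff.nullSet β δ)
      ≤ q + P.real {ω | (0 : EReal) <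
          ⨆ j ∈ FixedXKnockoff.nullSet β δ,
            ((FixedXKnockoff.solsOriginal X Xk (y ω) j
              + FixedXKnockoff.solsKnockoff X Xk shift (y ω) j : ℝ) : EReal)} := by
  open FixedXKnockoff in
  set S₀ := nullSet β δ with hS₀
  set c : Fin p ⊕ Fin p → ℝ := Sum.elim β shift with hc
  set z : Ω → Fin p ⊕ Fin p → ℝ := fun ω => c + olsMatrix X Xk *ᵥ noise ω with hz
  have hl : ∀ ω, solsOriginal X Xk (y ω) = z ω ∘ Sum.inl := by
    intro ω; funext j
    simp [solsOriginal, hy, olsEstimate_eq hG, hz, hc]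
  have hr : ∀ ω, solsKnockoff X Xk shift (y ω) = z ω ∘ Sum.inr := by
    intro ω; funext j
    rw [solsKnockoff, hy, olsEstimate_eq hG]
    simp [hz, hc]
    ring
  simp only [hl, hr]
  set W : Ω → Fin p → ℝ := fun ω => w (z ω ∘ Sum.inl) (z ω ∘ Sum.inr) with hW
  have hzm : AEMeasurable z P := by
    have : Measurable fun x : Fin n → ℝ => c + olsMatrix X Xk *ᵥ x :=
      (LinearMap.continuous_of_finiteDimensional
        (olsMatrix X Xk).mulVecLin).measurable.const_add c
    exact this.comp_aemeasurable hnoise.aemeasurable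
  have hWm : AEMeasurable W P := by
    have : Measurable fun x : Fin p ⊕ Fin p → ℝ => w (x ∘ Sum.inl) (x ∘ Sum.inr) :=
      hw_meas.comp (Measurable.prodMk
        (measurable_pi_lambda _ fun k => measurable_pi_apply _)
        (measurable_pi_lambda _ fun k => measurable_pi_apply _))
    exact this.comp_aemeasurable hzm
  have hbad : {ω | (0 : EReal) < ⨆ j ∈ S₀, (((z ω ∘ Sum.inl) j + (z ω ∘ Sum.inr) j : ℝ) : EReal)} =
      (z ⁻¹' nonposSums S₀)ᶜ := by
    ext ω
    simp [lt_iSup_iff, nonposSums, -EReal.coe_add]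
  have hgood : NullMeasurableSet (z ⁻¹' nonposSums S₀) P :=
    hzm.nullMeasurable (measurableSet_nonposSums S₀)
  rw [hbad]
  have hposm : ∀ j, AEMeasurable
      (fun ω => ENNReal.ofReal (if 0 < W ω j then looWeight q S₀ (W ω) j else 0)) P := fun j =>
    (Measurable.ite (measurableSet_lt measurable_const (measurable_pi_apply j))
      (measurable_looWeight q S₀ j) measurable_const).ennreal_ofReal.comp_aemeasurable hWm
  have hnegm : ∀ j, AEMeasurable
      (fun ω => ENNReal.ofReal (if W ω j < 0 then looWeight q S₀ (W ω) j else 0)) P := fun j =>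
    (Measurable.ite (measurableSet_lt (measurable_pi_apply j) measurable_const)
      (measurable_looWeight q S₀ j) measurable_const).ennreal_ofReal.comp_aemeasurable hWm
  have hnn : ∀ (r : Prop) [Decidable r] (ω : Ω) (j : Fin p),
      0 ≤ if r then looWeight q S₀ (W ω) j else 0 := fun r _ ω j => by
    split_ifs
    exacts [looWeight_nonneg _ _ _ _, le_rfl]
  have hmain : ∫⁻ ω, ENNReal.ofReal (fdp (selected q (W ω)) S₀) ∂P ≤
      ENNReal.ofReal q + P (z ⁻¹' nonposSums S₀)ᶜ := by
    calc ∫⁻ ω, ENNReal.ofReal (fdp (selected q (W ω)) S₀) ∂P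
        ≤ ∫⁻ ω, (ENNReal.ofReal q * ∑ j ∈ S₀, (z ⁻¹' nonposSums S₀).indicator
            (fun ω => ENNReal.ofReal (if 0 < W ω j then looWeight q S₀ (W ω) j else 0)) ω +
            (z ⁻¹' nonposSums S₀)ᶜ.indicator (fun _ => 1) ω) ∂P := by
          refine lintegral_mono fun ω => ?_
          by_cases hω : ω ∈ z ⁻¹' nonposSums S₀
          · simp only [Set.indicator_of_mem hω]
            refine le_add_right ?_
            rw [← ENNReal.ofReal_sum_of_nonneg fun j _ => hnn _ ω j, ← ENNReal.ofReal_mul hq0]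
            exact ENNReal.ofReal_le_ofReal (fdp_selected_le hq0 S₀ (W ω))
          · rw [Set.indicator_of_mem (s := (z ⁻¹' nonposSums S₀)ᶜ) hω]
            refine le_add_left ?_
            exact ENNReal.ofReal_le_one.2 (fdp_le_one _ _)
      _ = ENNReal.ofReal q * ∑ j ∈ S₀, ∫⁻ ω, (z ⁻¹' nonposSums S₀).indicator
            (fun ω => ENNReal.ofReal (if 0 < W ω j then looWeight q S₀ (W ω) j else 0)) ω ∂P +
            P (z ⁻¹' nonposSums S₀)ᶜ := by
          rw [lintegral_add_right' _ ((aemeasurable_const (b := 1)).indicator₀ hgood.compl),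
            lintegral_const_mul' _ _ ENNReal.ofReal_ne_top,
            lintegral_finsetSum' _ fun j _ => (hposm j).indicator₀ hgood,
            lintegral_indicator_const₀ hgood.compl, one_mul]
      _ ≤ ENNReal.ofReal q * ∑ j ∈ S₀, ∫⁻ ω,
            ENNReal.ofReal (if W ω j < 0 then looWeight q S₀ (W ω) j else 0) ∂P +
            P (z ⁻¹' nonposSums S₀)ᶜ := by
          refine add_le_add_left (mul_le_mul_right (Finset.sum_le_sum fun j hj => ?_) _) _
          refine lintegral_looWeight_pos_le hXk hG hnoise hw_meas hw_anti hw_sign q hj (c := c) ?_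
            (fun _ => rfl) fun _ => rfl
          have hβ : |β j| ≤ δ := by simpa [hS₀, nullSet] using hj
          simp only [hc, Sum.elim_inl, Sum.elim_inr]
          exact (hshift j).trans (abs_le.1 hβ).1
      _ = ENNReal.ofReal q * ∫⁻ ω, ENNReal.ofReal
            (∑ j ∈ S₀, if W ω j < 0 then looWeight q S₀ (W ω) j else 0) ∂P +
            P (z ⁻¹' nonposSums S₀)ᶜ := by
          rw [← lintegral_finsetSum' _ fun j _ => hnegm j]
          congr 3
          funext ω
          rw [ENNReal.ofReal_sum_of_nonneg fun j _ => hnn _ ω j]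
      _ ≤ ENNReal.ofReal q * ∫⁻ _, 1 ∂P + P (z ⁻¹' nonposSums S₀)ᶜ := by
          gcongr with ω
          exact ENNReal.ofReal_le_one.2 (sum_looWeight_neg_le_one q S₀ (W ω))
      _ = _ := by simp
  -- This direction needs no measurability of the FDP: the Bochner integral of a non-integrable
  -- function is 0.
  have hint : ENNReal.ofReal (FDR P (fun ω => selected q (W ω)) S₀) ≤
      ∫⁻ ω, ENNReal.ofReal (fdp (selected q (W ω)) S₀) ∂P := by
    have := enorm_integral_le_lintegral_enorm (μ := P) fun ω => fdp (selected q (W ω)) S₀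
    rw [Real.enorm_eq_ofReal (integral_nonneg fun ω => fdp_nonneg _ _)] at this
    simpa only [FDR, Real.enorm_eq_ofReal (fdp_nonneg _ _)] using this
  have hreal : ENNReal.ofReal q + P (z ⁻¹' nonposSums S₀)ᶜ =
      ENNReal.ofReal (q + P.real (z ⁻¹' nonposSums S₀)ᶜ) := by
    rw [ENNReal.ofReal_add hq0 measureReal_nonneg, ofReal_measureReal]
  exact (ENNReal.ofReal_le_ofReal_iff (add_nonneg hq0 measureReal_nonneg)).1
    ((hint.trans hmain).trans_eq hreal)
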